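/- For $x\in\mathbb R$ let $\|x\|$ denote the distance from $x$ to the nearest integer, and let $\varphi$ be Euler's totient function. Let $\alpha$ be an irrational real number that is not Liouville. Let $$\mu(\alpha)=\sup\{w>0:\ \|n\alpha\|<n^{-w}\text{ for infinitely many } n\in\mathbb N\}$$ be its diophantine exponent, which is finite, and put $\varepsilon=\dfrac{1}{10(1+\mu(\alpha))}$. Then there exist constants $c,C>0$ and $N_0\in\mathbb N$, depending only on $\alpha$, such that for every $\gamma\in\mathbb R$, every integer $N\ge N_0$ and every real $\rho$ with $N^{-2\varepsilon}\le\rho\le N^{-\varepsilon}$, we have $$c\,\rho N\ \le\ \sum_{\substack{N/20\le n\le N\\ \|n\alpha-\gamma\|\le\rho}}\frac{\varphi(n)}{n}\ \le\ C\,\rho N,$$ where the sum runs over positive integers $n$. -/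

import Mathlib

noncomputable section

/-- `‖x‖`: the distance from the real number `x` to the nearest integer. -/
def distNearestInt (x : ℝ) : ℝ := |x - round x|

/-- The diophantine exponent
`μ(α) = sup {w > 0 : ‖n α‖ < n ^ (-w) for infinitely many positive integers n}`.
For `α` irrational and not Liouville the set is nonempty and bounded above, so the supremum
in `ℝ` is the usual one. -/
def diophantineExponent (α : ℝ) : ℝ :=
  sSup {w : ℝ | 0 < w ∧
    {n : ℕ | 1 ≤ n ∧ distNearestInt (n * α) < (n : ℝ) ^ (-w)}.Infinite}

/-- `ε = 1 / (10 λ)`, where `λ = 1 + μ(α)`. -/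
def bohrEps (α : ℝ) : ℝ := 1 / (10 * (1 + diophantineExponent α))

/-- The inhomogeneous Bohr set `{n ∈ ℕ : 1 ≤ n ≤ N, ‖n α - γ‖ ≤ ρ}`. -/
def bohrSet (N : ℕ) (γ α ρ : ℝ) : Finset ℕ :=
  (Finset.Icc 1 N).filter fun n => distNearestInt (n * α - γ) ≤ ρ

/-- The intersection of the Bohr set with `[N / 20, N]`, where `N / 20` is the real quotient. -/
def bohrSetStar (N : ℕ) (γ α ρ : ℝ) : Finset ℕ :=
  (bohrSet N γ α ρ).filter fun n => (N : ℝ) / 20 ≤ n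

end

open Filter

/-! Write B for the Bohr set in `[N/20, N]` and X = N^(2ε). The upper bound is φ(n)/n ≤ 1 and a
count of B. For the lower bound, φ(n)/n ≥ exp(-2 ∑_{p ∣ n} 1/p), so by convexity it suffices that
∑_{p ∣ n} 1/p is bounded on average over B. Primes above X contribute at most 1 for each n. For p ≤
X, exchanging the sums and using |{n ∈ B : p ∣ n}| ≪ ρN/p leaves ρN ∑ 1/p².

Everything thus rests on the counts in `eventually_card_bohrSetStar`. Multiples n = md correspond to
m with m(dα) near γ. As α is not Liouville, dα has an approximation a/q with 3X ≤ q ≤ √N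
(`eventually_exists_denominator`). Since ma runs once through the residues mod q, each block of q
integers holds 2ρq ± 3 solutions, and ρq ≥ 3 absorbs the error. -/

theorem distNearestInt_le_iff {x r : ℝ} : distNearestInt x ≤ r ↔ ∃ m : ℤ, |x - m| ≤ r :=
  ⟨fun h => ⟨round x, h⟩, fun ⟨m, hm⟩ => (round_le x m).trans hm⟩

/-! ### Counting `n` with `n β` near `γ` modulo 1 -/

theorem card_Icc_ceil_floor_le {x y : ℝ} (h : x ≤ y + 1) :
    ((Finset.Icc ⌈x⌉ ⌊y⌋).card : ℝ) ≤ y - x + 1 := by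
  rw [Int.card_Icc]
  have h1 := Int.floor_le y
  have h2 := Int.le_ceil x
  rcases le_total 0 (⌊y⌋ + 1 - ⌈x⌉) with h0 | h0
  · have : (((⌊y⌋ + 1 - ⌈x⌉).toNat : ℤ) : ℝ) = ((⌊y⌋ + 1 - ⌈x⌉ : ℤ) : ℝ) := by
      rw [Int.toNat_of_nonneg h0]
    rw [Int.cast_natCast] at this
    rw [this]; push_cast; linarith
  · rw [Int.toNat_of_nonpos h0]; push_cast; linarith

theorem le_card_Icc_ceil_floor (x y : ℝ) :
    y - x - 1 ≤ ((Finset.Icc ⌈x⌉ ⌊y⌋).card : ℝ) := by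
  rw [Int.card_Icc]
  have h1 := Int.lt_floor_add_one y
  have h2 := Int.ceil_lt_add_one x
  have : (((⌊y⌋ + 1 - ⌈x⌉ : ℤ)) : ℝ) ≤ (((⌊y⌋ + 1 - ⌈x⌉).toNat : ℤ) : ℝ) := by
    exact_mod_cast Int.self_le_toNat _
  rw [Int.cast_natCast] at this
  push_cast at this
  linarith

/-- In a block of `q` consecutive integers, replacing `n β` by `n a / q` costs at most `1 / q` up to
a shift that is constant on the block. -/
theorem abs_block_error_le {β : ℝ} {a : ℤ} {q : ℕ} (hq : 0 < q)
    (hβ : |β - a / q| ≤ 1 / (q : ℝ) ^ 2) {s n : ℕ} (hn : n ∈ Finset.Ico s (s + q)) :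
    |((n : ℝ) - s) * (q * β - a)| ≤ 1 := by
  have hq' : (0 : ℝ) < q := by exact_mod_cast hq
  rw [Finset.mem_Ico] at hn
  have h1 : (s : ℝ) ≤ n := by exact_mod_cast hn.1
  have h2 : (n : ℝ) ≤ s + q := by exact_mod_cast hn.2.le
  have h3 : q * β - a = q * (β - a / q) := by field_simp
  rw [h3, abs_mul, abs_mul, abs_of_nonneg (by linarith : (0 : ℝ) ≤ n - s), abs_of_pos hq']
  calc ((n : ℝ) - s) * (q * |β - a / q|) ≤ q * (q * (1 / (q : ℝ) ^ 2)) := by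
        gcongr; linarith
    _ = 1 := by field_simp

/-- Multiplying by `q` turns solutions into integers congruent to `n a` mod `q` within `ρ q + 1` of
a fixed centre. They are distinct because `a` is invertible mod `q`. -/
theorem card_block_le {β : ℝ} {a : ℤ} {q : ℕ} (hq : 0 < q) (haq : IsCoprime a (q : ℤ))
    (hβ : |β - a / q| ≤ 1 / (q : ℝ) ^ 2) (s : ℕ) (γ : ℝ) {ρ : ℝ} (hρ : 0 ≤ ρ) :
    (((Finset.Ico s (s + q)).filter fun n : ℕ => distNearestInt (n * β - γ) ≤ ρ).card : ℝ)
      ≤ 2 * ρ * q + 3 := by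
  have hq' : (0 : ℝ) < q := by exact_mod_cast hq
  set t : ℝ := q * γ - s * (q * β - a) with ht
  have hle := card_Icc_ceil_floor_le (x := t - (ρ * q + 1)) (y := t + (ρ * q + 1))
    (by nlinarith [mul_nonneg hρ hq'.le])
  refine (Nat.cast_le.mpr (Finset.card_le_card_of_injOn
    (fun n : ℕ => (n : ℤ) * a - round ((n : ℝ) * β - γ) * q) ?_ ?_)).trans
    (hle.trans (by linarith))
  · intro n hn
    simp only [Finset.coe_filter, Set.mem_ofPred_eq] at hn
    have herr := abs_le.mp (abs_block_error_le hq hβ hn.1)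
    have hd := abs_le.mp hn.2
    simp only [Finset.coe_Icc, Set.mem_Icc, Int.ceil_le, Int.le_floor]
    push_cast
    constructor <;> nlinarith [mul_le_mul_of_nonneg_right hd.1 hq'.le,
      mul_le_mul_of_nonneg_right hd.2 hq'.le]
  · intro n hn m hm h
    simp only [Finset.coe_filter, Set.mem_ofPred_eq, Finset.mem_Ico] at hn hm
    have hdvd : (q : ℤ) ∣ ((n : ℤ) - m) * a :=
      ⟨round ((n : ℝ) * β - γ) - round ((m : ℝ) * β - γ), by linear_combination h⟩
    have h2 := haq.symm.dvd_of_dvd_mul_right hdvd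
    have h3 : (n : ℤ) - m = 0 := by
      apply Int.eq_zero_of_abs_lt_dvd h2
      rw [abs_lt]; omega
    omega

theorem le_card_block {β : ℝ} {a : ℤ} {q : ℕ} (hq : 0 < q) (haq : IsCoprime a (q : ℤ))
    (hβ : |β - a / q| ≤ 1 / (q : ℝ) ^ 2) (s : ℕ) (γ : ℝ) {ρ : ℝ} (hρ : ρ ≤ 1 / 2) :
    2 * ρ * q - 3 ≤
      (((Finset.Ico s (s + q)).filter fun n : ℕ => distNearestInt (n * β - γ) ≤ ρ).card : ℝ) := by
  have hq' : (0 : ℝ) < q := by exact_mod_cast hq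
  set t : ℝ := q * γ - s * (q * β - a) with ht
  have hle := le_card_Icc_ceil_floor (t - (ρ * q - 1)) (t + (ρ * q - 1))
  obtain ⟨u, v, huv⟩ := haq
  have hqz : (0 : ℤ) < q := by exact_mod_cast hq
  have hrep : ∀ k : ℤ, ∃ n : ℕ, n ∈ Finset.Ico s (s + q) ∧ ∃ m : ℤ, (n : ℤ) * a = k + m * q := by
    intro k
    have hpos := Int.emod_nonneg ((k - s * a) * u) hqz.ne'
    have hlt := Int.emod_lt_of_pos ((k - s * a) * u) hqz
    have hdm := Int.emod_add_mul_ediv ((k - s * a) * u) q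
    -- `u` inverts `a` mod `q`, so this is the element of the block with `n a ≡ k`.
    refine ⟨s + (((k - s * a) * u) % q).toNat, ?_,
      -(a * (((k - s * a) * u) / q)) - v * (k - s * a), ?_⟩
    · rw [Finset.mem_Ico]; omega
    · push_cast
      rw [Int.toNat_of_nonneg hpos]
      linear_combination a * hdm + (k - s * a) * huv
  choose n hn m hm using hrep
  refine (by linarith : 2 * ρ * q - 3 ≤ t + (ρ * q - 1) - (t - (ρ * q - 1)) - 1).trans
    (hle.trans (Nat.cast_le.mpr (Finset.card_le_card_of_injOn n ?_ ?_)))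
  · intro k hk
    simp only [Finset.coe_Icc, Set.mem_Icc, Int.ceil_le, Int.le_floor] at hk
    simp only [Finset.coe_filter, Set.mem_ofPred_eq]
    refine ⟨hn k, distNearestInt_le_iff.mpr ⟨m k, ?_⟩⟩
    have herr := abs_le.mp (abs_block_error_le hq hβ (hn k))
    have hmk : (n k : ℝ) * a = k + m k * q := by exact_mod_cast hm k
    rw [abs_le]
    constructor
    · refine le_of_mul_le_mul_right ?_ hq'
      nlinarith
    · refine le_of_mul_le_mul_right ?_ hq'
      nlinarith
  · intro k hk l hl h
    simp only [Finset.coe_Icc, Set.mem_Icc, Int.ceil_le, Int.le_floor] at hk hl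
    have h1 := hm k
    have h2 := hm l
    rw [h] at h1
    have hdvd : (q : ℤ) ∣ k - l := ⟨m l - m k, by linear_combination h2 - h1⟩
    -- As `ρ ≤ 1 / 2`, the interval of targets is shorter than `q`, so distinct targets are distinct
    -- residues.
    have h3 : k - l = 0 := by
      apply Int.eq_zero_of_abs_lt_dvd hdvd
      have : |(k : ℝ) - l| < q := by
        rw [abs_lt]; constructor <;> nlinarith
      exact_mod_cast this
    omega

theorem card_initial_le {β : ℝ} {a : ℤ} {q : ℕ} (hq : 0 < q) (haq : IsCoprime a (q : ℤ))
    (hβ : |β - a / q| ≤ 1 / (q : ℝ) ^ 2) (M : ℕ) (γ : ℝ) {ρ : ℝ} (hρ : 0 ≤ ρ) :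
    (((Finset.range (M + 1)).filter fun n : ℕ => distNearestInt (n * β - γ) ≤ ρ).card : ℝ)
      ≤ ((M : ℝ) / q + 1) * (2 * ρ * q + 3) := by
  have hsub : ((Finset.range (M + 1)).filter fun n : ℕ => distNearestInt (n * β - γ) ≤ ρ) ⊆
      (Finset.range (M / q + 1)).biUnion fun i =>
        (Finset.Ico (i * q) (i * q + q)).filter fun n : ℕ => distNearestInt (n * β - γ) ≤ ρ := by
    intro n hn
    simp only [Finset.mem_filter, Finset.mem_range, Finset.mem_biUnion, Finset.mem_Ico] at hn ⊢
    refine ⟨n / q, ?_, ⟨Nat.div_mul_le_self n q, ?_⟩, hn.2⟩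
    · exact Nat.lt_succ_of_le (Nat.div_le_div_right (by omega))
    · have := Nat.div_add_mod' n q
      have := Nat.mod_lt n hq
      omega
  have h1 := (Finset.card_le_card hsub).trans Finset.card_biUnion_le
  calc _ ≤ ((∑ i ∈ Finset.range (M / q + 1), ((Finset.Ico (i * q) (i * q + q)).filter
          fun n : ℕ => distNearestInt (n * β - γ) ≤ ρ).card : ℕ) : ℝ) := by exact_mod_cast h1
    _ ≤ ∑ i ∈ Finset.range (M / q + 1), (2 * ρ * q + 3) := by
        push_cast
        exact Finset.sum_le_sum fun i _ => card_block_le hq haq hβ _ γ hρ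
    _ = (((M / q : ℕ) : ℝ) + 1) * (2 * ρ * q + 3) := by
        simp; ring
    _ ≤ _ := by
        gcongr
        exact Nat.cast_div_le

theorem le_card_interval {β : ℝ} {a : ℤ} {q : ℕ} (hq : 0 < q) (haq : IsCoprime a (q : ℤ))
    (hβ : |β - a / q| ≤ 1 / (q : ℝ) ^ 2) (s T : ℕ) (γ : ℝ) {ρ : ℝ} (hρ : ρ ≤ 1 / 2) :
    T * (2 * ρ * q - 3) ≤ (((Finset.Ico s (s + T * q)).filter
      fun n : ℕ => distNearestInt (n * β - γ) ≤ ρ).card : ℝ) := by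
  induction T with
  | zero => simp
  | succ T ih =>
    have hsplit : Finset.Ico s (s + (T + 1) * q) =
        Finset.Ico s (s + T * q) ∪ Finset.Ico (s + T * q) (s + T * q + q) := by
      rw [Finset.Ico_union_Ico_eq_Ico (by omega) (by omega)]
      congr 1; ring
    have hdisj := Finset.Ico_disjoint_Ico_consecutive s (s + T * q) (s + T * q + q)
    rw [hsplit, Finset.filter_union,
      Finset.card_union_of_disjoint (Finset.disjoint_filter_filter hdisj)]
    have := le_card_block hq haq hβ (s + T * q) γ hρ
    push_cast at this ⊢
    linarith

/-! ### Diophantine input: approximations with large denominator -/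

theorem diophantineExponent_nonneg (α : ℝ) : 0 ≤ diophantineExponent α :=
  Real.sSup_nonneg fun _ hw => hw.1.le

theorem bohrEps_pos (α : ℝ) : 0 < bohrEps α := by
  have := diophantineExponent_nonneg α
  unfold bohrEps
  positivity

theorem bohrEps_le (α : ℝ) : bohrEps α ≤ 1 / 10 := by
  have := diophantineExponent_nonneg α
  unfold bohrEps
  exact one_div_le_one_div_of_le (by norm_num) (by linarith)

theorem distNearestInt_pos {α : ℝ} (hα : Irrational α) {n : ℕ} (hn : 1 ≤ n) :
    0 < distNearestInt (n * α) := by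
  refine abs_pos.mpr (sub_ne_zero.mpr ?_)
  exact (hα.natCast_mul (by omega)).ne_int _

theorem bddAbove_diophantine_exponents {α : ℝ} (hα : Irrational α) (hL : ¬ Liouville α) :
    BddAbove {w : ℝ | 0 < w ∧
      {n : ℕ | 1 ≤ n ∧ distNearestInt (n * α) < (n : ℝ) ^ (-w)}.Infinite} := by
  unfold Liouville at hL
  push Not at hL
  obtain ⟨k, hk⟩ := hL
  refine ⟨k, fun w hw => ?_⟩
  -- The Liouville condition only concerns denominators above 1.
  obtain ⟨n, ⟨hn1, hn⟩, hn2⟩ := hw.2.exists_gt 1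
  by_contra! hlt
  have hn1' : (1 : ℝ) < n := by exact_mod_cast hn2
  have hn0 : (0 : ℝ) < n := by linarith
  have h := hk (round ((n : ℝ) * α)) n (by exact_mod_cast hn2) (by
    have := hα.ne_rat ((round ((n : ℝ) * α) : ℚ) / n)
    push_cast at this ⊢
    exact this)
  push_cast at h
  have h1 : distNearestInt (n * α) = n * |α - round ((n : ℝ) * α) / n| := by
    unfold distNearestInt
    rw [← abs_of_pos hn0, ← abs_mul, abs_of_pos hn0]
    congr 1; field_simp
  have h2 : 1 / (n : ℝ) ^ k ≤ distNearestInt (n * α) := by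
    rw [h1]
    exact h.trans (le_mul_of_one_le_left (abs_nonneg _) hn1'.le)
  have h3 : (n : ℝ) ^ (-w) ≤ 1 / (n : ℝ) ^ k := by
    rw [one_div, ← Real.rpow_natCast, ← Real.rpow_neg hn0.le]
    exact Real.rpow_le_rpow_of_exponent_le hn1'.le (by linarith)
  linarith

/-- The exponent exceeds `μ(α)`, so only finitely many `n` violate the bound with constant 1.
Irrationality keeps their distances positive, and `c` absorbs them. -/
theorem exists_le_distNearestInt {α : ℝ} (hα : Irrational α) (hL : ¬ Liouville α) :
    ∃ c : ℝ, 0 < c ∧ ∀ n : ℕ, 1 ≤ n →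
      c * (n : ℝ) ^ (-(1 + diophantineExponent α)) ≤ distNearestInt (n * α) := by
  set w := 1 + diophantineExponent α with hw
  have hw0 : 0 < w := by linarith [diophantineExponent_nonneg α]
  have hfin : {n : ℕ | 1 ≤ n ∧ distNearestInt (n * α) < (n : ℝ) ^ (-w)}.Finite := by
    by_contra hinf
    have : w ≤ diophantineExponent α :=
      le_csSup (bddAbove_diophantine_exponents hα hL) ⟨hw0, hinf⟩
    linarith
  have hmin : ∃ c : ℝ, 0 < c ∧ ∀ n ∈ hfin.toFinset, c ≤ distNearestInt (n * α) := by
    rcases hfin.toFinset.eq_empty_or_nonempty with he | hne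
    · exact ⟨1, one_pos, by simp [he]⟩
    · obtain ⟨m, hm, hmin⟩ := hfin.toFinset.exists_min_image
        (fun n : ℕ => distNearestInt (n * α)) hne
      exact ⟨_, distNearestInt_pos hα ((hfin.mem_toFinset.mp hm).1), hmin⟩
  obtain ⟨c, hc, hcmin⟩ := hmin
  refine ⟨min c 1, by positivity, fun n hn => ?_⟩
  have hn1 : (1 : ℝ) ≤ n := by exact_mod_cast hn
  have hp : 0 ≤ (n : ℝ) ^ (-w) := by positivity
  by_cases h : distNearestInt (n * α) < (n : ℝ) ^ (-w)
  · have h1 := hcmin n (hfin.mem_toFinset.mpr ⟨hn, h⟩)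
    have h2 : (n : ℝ) ^ (-w) ≤ 1 := Real.rpow_le_one_of_one_le_of_nonpos hn1 (by linarith)
    calc min c 1 * (n : ℝ) ^ (-w) ≤ c * 1 := by
          gcongr; exact min_le_left _ _
      _ ≤ _ := by linarith
  · push Not at h
    calc min c 1 * (n : ℝ) ^ (-w) ≤ 1 * (n : ℝ) ^ (-w) := by
          gcongr; exact min_le_right _ _
      _ ≤ _ := by linarith

/-- Dirichlet gives `q ≤ √N` with `‖q d α‖ ≤ N^(-1/2)`. If `q < 3 N^(2ε)`, then `q d ≤ 3 N^(4ε)`,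
and since `ε (1 + μ(α)) = 1/10` the distance is `≫ N^(-2/5)`, a contradiction for large `N`. -/
theorem eventually_exists_denominator {α : ℝ} (hα : Irrational α) (hL : ¬ Liouville α) :
    ∀ᶠ N : ℕ in atTop, ∀ d : ℕ, 1 ≤ d → (d : ℝ) ≤ (N : ℝ) ^ (2 * bohrEps α) →
      ∃ (a : ℤ) (q : ℕ), 0 < q ∧ IsCoprime a (q : ℤ) ∧
        |d * α - a / q| ≤ 1 / (q : ℝ) ^ 2 ∧ (q : ℝ) ≤ √N ∧
        3 * (N : ℝ) ^ (2 * bohrEps α) ≤ q := by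
  obtain ⟨c, hc, hcα⟩ := exists_le_distNearestInt hα hL
  set w := 1 + diophantineExponent α with hw
  have hw0 : 0 < w := by linarith [diophantineExponent_nonneg α]
  have hlim : ∀ᶠ N : ℕ in atTop, (3 : ℝ) ^ w / c < (N : ℝ) ^ (1 / 10 : ℝ) :=
    ((tendsto_rpow_atTop (by norm_num)).comp tendsto_natCast_atTop_atTop).eventually_gt_atTop _
  filter_upwards [hlim, eventually_ge_atTop 1] with N hN hN1 d hd hdX
  have hN0 : (0 : ℝ) < N := by exact_mod_cast hN1
  have hQ : 0 < Nat.sqrt N := Nat.sqrt_pos.mpr hN1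
  obtain ⟨r, hr, hrQ⟩ := Real.exists_rat_abs_sub_le_and_den_le (d * α) hQ
  have hq0 : (0 : ℝ) < r.den := by exact_mod_cast r.den_pos
  have hqQ : (r.den : ℝ) ≤ Nat.sqrt N := by exact_mod_cast hrQ
  have hrcast : (r : ℝ) = (r.num : ℝ) / (r.den : ℝ) := Rat.cast_def r
  refine ⟨r.num, r.den, r.den_pos, r.isCoprime_num_den, ?_, hqQ.trans Real.nat_sqrt_le_real_sqrt, ?_⟩
  · rw [← hrcast]
    refine hr.trans (one_div_le_one_div_of_le (by positivity) ?_)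
    nlinarith
  by_contra! hlt
  set X := (N : ℝ) ^ (2 * bohrEps α) with hX
  have hX0 : 0 < X := by positivity
  have hsq : √(N : ℝ) ≤ Nat.sqrt N + 1 := Real.real_sqrt_le_nat_sqrt_succ
  have hs0 : 0 < √(N : ℝ) := Real.sqrt_pos.mpr hN0
  have h1 : distNearestInt ((r.den * d : ℕ) * α) ≤ 1 / √(N : ℝ) := by
    refine distNearestInt_le_iff.mpr ⟨r.num, ?_⟩
    have he : ((r.den * d : ℕ) : ℝ) * α - r.num = r.den * (d * α - r) := by
      rw [hrcast]; push_cast; field_simp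
    rw [he, abs_mul, abs_of_pos hq0]
    calc (r.den : ℝ) * |d * α - r| ≤ r.den * (1 / ((Nat.sqrt N + 1) * r.den)) := by gcongr
      _ = 1 / (Nat.sqrt N + 1) := by field_simp
      _ ≤ _ := one_div_le_one_div_of_le hs0 hsq
  have h2 := (hcα (r.den * d) (Nat.mul_pos r.den_pos hd)).trans h1
  have hd0 : (0 : ℝ) < d := by exact_mod_cast hd
  have hqd : ((r.den * d : ℕ) : ℝ) ≤ 3 * X ^ 2 := by
    push_cast; nlinarith
  have hqd0 : (0 : ℝ) < ((r.den * d : ℕ) : ℝ) := by push_cast; positivity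
  have h3 : ((r.den * d : ℕ) : ℝ) ^ w ≤ 3 ^ w * (N : ℝ) ^ (2 / 5 : ℝ) := by
    refine (Real.rpow_le_rpow hqd0.le hqd hw0.le).trans_eq ?_
    rw [Real.mul_rpow (by norm_num) (by positivity), hX, ← Real.rpow_natCast, ← Real.rpow_mul hN0.le,
      ← Real.rpow_mul hN0.le]
    congr 2
    unfold bohrEps
    rw [← hw]
    push_cast
    field_simp
    norm_num
  have h4 : c * √(N : ℝ) ≤ ((r.den * d : ℕ) : ℝ) ^ w := by
    rw [Real.rpow_neg hqd0.le] at h2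
    have : 0 < ((r.den * d : ℕ) : ℝ) ^ w := by positivity
    rw [← div_eq_mul_inv, div_le_div_iff₀ this hs0] at h2
    linarith
  have h5 : √(N : ℝ) = (N : ℝ) ^ (1 / 10 : ℝ) * (N : ℝ) ^ (2 / 5 : ℝ) := by
    rw [Real.sqrt_eq_rpow, ← Real.rpow_add hN0]; norm_num
  have h6 : 0 < (N : ℝ) ^ (2 / 5 : ℝ) := by positivity
  rw [div_lt_iff₀ hc] at hN
  have h7 := h4.trans h3
  rw [h5, ← mul_assoc] at h7
  have := le_of_mul_le_mul_right h7 h6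
  linarith

/-! ### Size of the Bohr set and of its multiples of `d` -/

theorem eventually_card_bohrSetStar {α : ℝ} (hα : Irrational α) (hL : ¬ Liouville α) :
    ∀ᶠ N : ℕ in atTop, ∀ γ ρ : ℝ, (N : ℝ) ^ (-2 * bohrEps α) ≤ ρ → ρ ≤ (N : ℝ) ^ (-bohrEps α) →
      ρ * N / 2 ≤ (bohrSetStar N γ α ρ).card ∧
      ∀ d : ℕ, 1 ≤ d → (d : ℝ) ≤ (N : ℝ) ^ (2 * bohrEps α) →
        (((bohrSetStar N γ α ρ).filter fun n => d ∣ n).card : ℝ) ≤ 10 * ρ * N / d := by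
  have hε := bohrEps_pos α
  have hlim : ∀ᶠ N : ℕ in atTop, (N : ℝ) ^ (-bohrEps α) < 1 / 2 :=
    ((tendsto_rpow_neg_atTop hε).comp tendsto_natCast_atTop_atTop).eventually_lt_const (by norm_num)
  filter_upwards [eventually_exists_denominator hα hL, hlim, eventually_ge_atTop 100]
    with N hN hhalf hN100 γ ρ hρ1 hρ2
  have hN100' : (100 : ℝ) ≤ N := by exact_mod_cast hN100
  have hN0 : (0 : ℝ) < N := by linarith
  set X := (N : ℝ) ^ (2 * bohrEps α) with hX
  have hX1 : 1 ≤ X := Real.one_le_rpow (by linarith) (by linarith)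
  have hρX : 1 ≤ ρ * X := by
    have : (N : ℝ) ^ (-2 * bohrEps α) * X = 1 := by
      rw [hX, ← Real.rpow_add hN0]; simp
    nlinarith
  have hρ0 : 0 < ρ := lt_of_lt_of_le (by positivity) hρ1
  have hXs : X ≤ √(N : ℝ) := by
    rw [Real.sqrt_eq_rpow]
    exact Real.rpow_le_rpow_of_exponent_le (by linarith) (by linarith [bohrEps_le α])
  have hss : √(N : ℝ) * √(N : ℝ) = N := Real.mul_self_sqrt hN0.le
  have hs0 : 0 ≤ √(N : ℝ) := Real.sqrt_nonneg _
  constructor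
  · obtain ⟨a, q, hq, haq, hβ, hqs, hqX⟩ := hN 1 le_rfl (by simpa using hX1)
    have hq0 : (0 : ℝ) < q := by exact_mod_cast hq
    rw [Nat.cast_one, one_mul] at hβ
    set s := ⌈(N : ℝ) / 20⌉₊ with hs
    have hs1 : (s : ℝ) < N / 20 + 1 := Nat.ceil_lt_add_one (by positivity)
    have hs2 : (N : ℝ) / 20 ≤ s := Nat.le_ceil _
    have hsN : s ≤ N := by
      have : (s : ℝ) ≤ N := by linarith
      exact_mod_cast this
    have hs10 : 10 ≤ √(N : ℝ) := Real.le_sqrt_of_sq_le (by linarith)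
    set T := (N - s) / q with hT
    have hTq : T * q ≤ N - s := Nat.div_mul_le_self _ _
    have hTlow : (N : ℝ) / 2 ≤ T * q := by
      have h1 : N - s < T * q + q := by
        have := Nat.div_add_mod' (N - s) q
        have := Nat.mod_lt (N - s) hq
        rw [← hT] at *
        omega
      have h2 : N < T * q + q + s := by omega
      have h3 : (N : ℝ) < T * q + q + s := by exact_mod_cast h2
      nlinarith
    have hlow := le_card_interval hq haq hβ s T γ (hρ2.trans hhalf.le)
    have hsub : ((Finset.Ico s (s + T * q)).filter
        fun n : ℕ => distNearestInt (n * α - γ) ≤ ρ) ⊆ bohrSetStar N γ α ρ := by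
      intro n hn
      simp only [bohrSetStar, bohrSet, Finset.mem_filter, Finset.mem_Ico, Finset.mem_Icc] at hn ⊢
      have h1 : (s : ℝ) ≤ n := by exact_mod_cast hn.1.1
      have h2 : (0 : ℝ) < n := by linarith
      have h3 : 0 < n := by exact_mod_cast h2
      exact ⟨⟨⟨h3, by omega⟩, hn.2⟩, by linarith⟩
    have hcard : (_ : ℝ) ≤ _ := Nat.cast_le.mpr (Finset.card_le_card hsub)
    refine le_trans ?_ (hlow.trans hcard)
    -- Hence `2 ρ q - 3 ≥ ρ q`, and the `T` blocks give `T q ρ ≥ ρ N / 2`.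
    have hρq : 3 ≤ ρ * q := by nlinarith
    have hT0 : (0 : ℝ) ≤ T := Nat.cast_nonneg _
    nlinarith
  · intro d hd hdX
    obtain ⟨a, q, hq, haq, hβ, hqs, hqX⟩ := hN d hd hdX
    have hq0 : (0 : ℝ) < q := by exact_mod_cast hq
    have hd0 : (0 : ℝ) < d := by exact_mod_cast hd
    have hρq : 3 ≤ ρ * q := by nlinarith
    have hup := card_initial_le hq haq hβ (N / d) γ hρ0.le
    have hinj : ((bohrSetStar N γ α ρ).filter fun n => d ∣ n).card ≤
        ((Finset.range (N / d + 1)).filter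
          fun n : ℕ => distNearestInt (n * (d * α) - γ) ≤ ρ).card := by
      refine Finset.card_le_card_of_injOn (fun n => n / d) ?_ ?_
      · intro n hn
        simp only [bohrSetStar, bohrSet, Finset.coe_filter, Set.mem_ofPred_eq, Finset.mem_filter,
          Finset.mem_Icc, Finset.mem_range] at hn ⊢
        refine ⟨Nat.lt_succ_of_le (Nat.div_le_div_right hn.1.1.1.2), ?_⟩
        rw [Nat.cast_div hn.2 hd0.ne', ← mul_assoc, div_mul_cancel₀ _ hd0.ne']
        exact hn.1.1.2
      · intro n hn m hm h
        simp only [Finset.coe_filter, Set.mem_ofPred_eq] at hn hm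
        exact (Nat.div_left_inj hn.2 hm.2).mp h
    have hinj' : (_ : ℝ) ≤ _ := Nat.cast_le.mpr hinj
    refine hinj'.trans (hup.trans ?_)
    -- At least one full block fits below `N / d`, so the incomplete block at most doubles the
    -- count.
    have hdq : (q : ℝ) * d ≤ N := by
      calc (q : ℝ) * d ≤ √N * √N := by gcongr; exact hdX.trans hXs
        _ = N := hss
    have h1 : ((N / d : ℕ) : ℝ) / q ≤ (N : ℝ) / d / q := by
      gcongr; exact Nat.cast_div_le
    have h2 : 1 ≤ (N : ℝ) / d / q := by
      rw [div_div, one_le_div (by positivity)]; linarith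
    calc (((N / d : ℕ) : ℝ) / q + 1) * (2 * ρ * q + 3)
        ≤ (2 * ((N : ℝ) / d / q)) * (3 * (ρ * q)) := by
          refine mul_le_mul (by linarith) (by linarith) ?_ (by linarith)
          linarith [mul_pos hρ0 hq0]
      _ = 6 * ρ * N / d := by field_simp; norm_num
      _ ≤ _ := by
          have : 0 ≤ ρ * N := by positivity
          gcongr ?_ / _
          linarith

/-! ### Averaging `φ(n) / n` -/

theorem exp_neg_two_mul_le_one_sub {x : ℝ} (h0 : 0 ≤ x) (h1 : x ≤ 1 / 2) :
    Real.exp (-(2 * x)) ≤ 1 - x := by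
  rw [Real.exp_neg, inv_le_iff_one_le_mul₀ (Real.exp_pos _)]
  -- `(1 - x) (1 + 2 x) ≥ 1` on `[0, 1/2]`.
  nlinarith [Real.add_one_le_exp (2 * x)]

/-- A lower bound for `φ(n) / n` in terms of `∑ 1 / p` over the primes `p` dividing `n`. -/
theorem exp_neg_sum_inv_le_totient_div {n : ℕ} (hn : n ≠ 0) :
    Real.exp (-(2 * ∑ p ∈ n.primeFactors, (p : ℝ)⁻¹)) ≤ (Nat.totient n : ℝ) / n := by
  have h : (Nat.totient n : ℝ) = n * ∏ p ∈ n.primeFactors, (1 - (p : ℝ)⁻¹) := by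
    have := congrArg (fun x : ℚ => (x : ℝ)) (Nat.totient_eq_mul_prod_factors n)
    push_cast at this
    exact this
  rw [h, mul_div_cancel_left₀ _ (by exact_mod_cast hn), Finset.mul_sum, ← Finset.sum_neg_distrib,
    Real.exp_sum]
  refine Finset.prod_le_prod (fun _ _ => (Real.exp_pos _).le) fun p hp => ?_
  have h2 : (2 : ℝ) ≤ p := by exact_mod_cast (Nat.prime_of_mem_primeFactors hp).two_le
  exact exp_neg_two_mul_le_one_sub (by positivity) (by
    rw [one_div]; exact inv_anti₀ (by norm_num) h2)

theorem card_primeFactors_le_log {n N : ℕ} (hn : n ≠ 0) (hnN : n ≤ N) :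
    n.primeFactors.card ≤ Nat.log 2 N := by
  refine Nat.le_log_of_pow_le (by norm_num) ?_
  refine (Finset.pow_card_le_prod _ (fun p => p) 2
    fun p hp => (Nat.prime_of_mem_primeFactors hp).two_le).trans ?_
  exact (Nat.le_of_dvd (Nat.pos_of_ne_zero hn) (Nat.prod_primeFactors_dvd n)).trans hnN

/-- Primes above `X` contribute at most `1` to `∑ 1 / p`, once `log₂ N ≤ X`. -/
theorem sum_inv_primeFactors_le {n N : ℕ} {X : ℝ} (hn : n ≠ 0) (hnN : n ≤ N)
    (hX : (Nat.log 2 N : ℝ) ≤ X) (hX0 : 0 < X) :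
    ∑ p ∈ n.primeFactors, (p : ℝ)⁻¹ ≤
      (∑ p ∈ Finset.Ioo 0 (⌊X⌋₊ + 1), if p ∣ n then (p : ℝ)⁻¹ else 0) + 1 := by
  rw [← Finset.sum_filter_add_sum_filter_not n.primeFactors (fun p : ℕ => (p : ℝ) ≤ X)]
  refine add_le_add ?_ ?_
  · rw [← Finset.sum_filter]
    refine Finset.sum_le_sum_of_subset_of_nonneg ?_ fun _ _ _ => by positivity
    intro p hp
    simp only [Finset.mem_filter, Finset.mem_Ioo] at hp ⊢
    exact ⟨⟨(Nat.prime_of_mem_primeFactors hp.1).pos, Nat.lt_succ_of_le (Nat.le_floor hp.2)⟩,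
      Nat.dvd_of_mem_primeFactors hp.1⟩
  · calc ∑ p ∈ n.primeFactors.filter (fun p : ℕ => ¬ (p : ℝ) ≤ X), (p : ℝ)⁻¹
        ≤ ∑ p ∈ n.primeFactors.filter (fun p : ℕ => ¬ (p : ℝ) ≤ X), X⁻¹ := by
          refine Finset.sum_le_sum fun p hp => inv_anti₀ hX0 ?_
          exact (not_le.mp (Finset.mem_filter.mp hp).2).le
      _ ≤ Nat.log 2 N * X⁻¹ := by
          rw [Finset.sum_const, nsmul_eq_mul]
          gcongr
          exact (Finset.card_filter_le _ _).trans (card_primeFactors_le_log hn hnN)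
      _ ≤ X * X⁻¹ := by gcongr
      _ = 1 := mul_inv_cancel₀ hX0.ne'

/-- If every `d ≤ X` divides at most `A / d` elements of `B ⊆ [1, N]`, where `log₂ N ≤ X`, then
`∑ 1 / p` is bounded on average over `B`. -/
theorem sum_sum_inv_primeFactors_le {B : Finset ℕ} {N : ℕ} {X A : ℝ}
    (hB : ∀ n ∈ B, n ≠ 0 ∧ n ≤ N) (hX : (Nat.log 2 N : ℝ) ≤ X) (hX1 : 1 ≤ X) (hA : 0 ≤ A)
    (hd : ∀ d : ℕ, 1 ≤ d → (d : ℝ) ≤ X → ((B.filter fun n => d ∣ n).card : ℝ) ≤ A / d) :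
    ∑ n ∈ B, ∑ p ∈ n.primeFactors, (p : ℝ)⁻¹ ≤ 3 * A := by
  have hcard : (B.card : ℝ) ≤ A := by
    have := hd 1 le_rfl (by simpa using hX1)
    simpa using this
  calc ∑ n ∈ B, ∑ p ∈ n.primeFactors, (p : ℝ)⁻¹
      ≤ ∑ n ∈ B, ((∑ p ∈ Finset.Ioo 0 (⌊X⌋₊ + 1), if p ∣ n then (p : ℝ)⁻¹ else 0) + 1) :=
        Finset.sum_le_sum fun n hn =>
          sum_inv_primeFactors_le (hB n hn).1 (hB n hn).2 hX (by linarith)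
    _ = (∑ p ∈ Finset.Ioo 0 (⌊X⌋₊ + 1), ((B.filter fun n => p ∣ n).card : ℝ) * (p : ℝ)⁻¹)
          + B.card := by
        rw [Finset.sum_add_distrib, Finset.sum_comm]
        simp [← Finset.sum_filter]
    -- Here `p` runs over all integers up to `X`: `∑ 1 / p ^ 2 ≤ 2` needs no primality.
    _ ≤ (∑ p ∈ Finset.Ioo 0 (⌊X⌋₊ + 1), A * ((p : ℝ) ^ 2)⁻¹) + A := by
        refine add_le_add (Finset.sum_le_sum fun p hp => ?_) hcard
        rw [Finset.mem_Ioo] at hp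
        have hpX : (p : ℝ) ≤ X := (Nat.le_floor_iff (by linarith)).mp (Nat.le_of_lt_succ hp.2)
        calc ((B.filter fun n => p ∣ n).card : ℝ) * (p : ℝ)⁻¹ ≤ A / p * (p : ℝ)⁻¹ := by
              gcongr; exact hd p hp.1 hpX
          _ = A * ((p : ℝ) ^ 2)⁻¹ := by rw [pow_two, mul_inv, div_eq_mul_inv]; ring
    _ ≤ A * 2 + A := by
        rw [← Finset.mul_sum]
        gcongr
        simpa using sum_Ioo_inv_sq_le (α := ℝ) 0 (⌊X⌋₊ + 1)
    _ = 3 * A := by ring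

/-- Jensen's inequality for `exp (-2 x)`, by the tangent line at `K`. -/
theorem card_mul_exp_le_sum_totient_div {B : Finset ℕ} {K : ℝ} (hB : ∀ n ∈ B, n ≠ 0)
    (hK : ∑ n ∈ B, ∑ p ∈ n.primeFactors, (p : ℝ)⁻¹ ≤ K * B.card) :
    Real.exp (-(2 * K)) * B.card ≤ ∑ n ∈ B, (Nat.totient n : ℝ) / n := by
  have htan : ∀ n ∈ B, Real.exp (-(2 * K)) *
      (1 + 2 * K - 2 * ∑ p ∈ n.primeFactors, (p : ℝ)⁻¹) ≤ (Nat.totient n : ℝ) / n := by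
    intro n hn
    refine le_trans ?_ (exp_neg_sum_inv_le_totient_div (hB n hn))
    set f := ∑ p ∈ n.primeFactors, (p : ℝ)⁻¹
    have h : Real.exp (-(2 * f)) = Real.exp (-(2 * K)) * Real.exp (2 * K - 2 * f) := by
      rw [← Real.exp_add]; congr 1; ring
    rw [h]
    gcongr
    linarith [Real.add_one_le_exp (2 * K - 2 * f)]
  refine le_trans ?_ (Finset.sum_le_sum htan)
  rw [← Finset.mul_sum, Finset.sum_sub_distrib, ← Finset.mul_sum, Finset.sum_const, nsmul_eq_mul]
  gcongr
  linarith

theorem eventually_log_le_rpow {r : ℝ} (hr : 0 < r) :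
    ∀ᶠ N : ℕ in atTop, (Nat.log 2 N : ℝ) ≤ (N : ℝ) ^ r := by
  -- The constant `log 2` converts natural logarithms to base 2.
  have h := ((isLittleO_log_rpow_atTop hr).comp_tendsto
    tendsto_natCast_atTop_atTop).bound (Real.log_pos one_lt_two)
  filter_upwards [h, eventually_ge_atTop 1] with N hN hN1
  have hN1' : (1 : ℝ) ≤ N := by exact_mod_cast hN1
  have hl2 := Real.log_pos one_lt_two
  simp only [Function.comp, Real.norm_eq_abs] at hN
  rw [abs_of_nonneg (Real.log_nonneg hN1'), abs_of_nonneg (by positivity)] at hN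
  have h2 : ((2 ^ Nat.log 2 N : ℕ) : ℝ) ≤ N := by
    exact_mod_cast Nat.pow_log_le_self 2 (by omega)
  have h3 := Real.log_le_log (by positivity) h2
  push_cast at h3
  rw [Real.log_pow] at h3
  refine le_of_mul_le_mul_right ?_ hl2
  linarith

theorem corollary3p5 (α : ℝ) (hα : Irrational α) (hL : ¬ Liouville α) :
    ∃ c C : ℝ, 0 < c ∧ 0 < C ∧ ∃ N₀ : ℕ, ∀ (γ : ℝ) (N : ℕ) (ρ : ℝ), N₀ ≤ N →
      (N : ℝ) ^ (-2 * bohrEps α) ≤ ρ → ρ ≤ (N : ℝ) ^ (-bohrEps α) →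
        c * (ρ * N) ≤ ∑ n ∈ bohrSetStar N γ α ρ, (Nat.totient n : ℝ) / n ∧
        ∑ n ∈ bohrSetStar N γ α ρ, (Nat.totient n : ℝ) / n ≤ C * (ρ * N) := by
  have hε := bohrEps_pos α
  obtain ⟨N₀, hN₀⟩ := eventually_atTop.mp ((eventually_card_bohrSetStar hα hL).and
    ((eventually_log_le_rpow (r := 2 * bohrEps α) (by positivity)).and (eventually_ge_atTop 1)))
  -- With `A = 10 ρ N` the prime sums total at most `30 ρ N`, which is at most 60 times the
  -- cardinality, itself at least `ρ N / 2`.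
  refine ⟨Real.exp (-(2 * 60)) / 2, 10, by positivity, by norm_num, N₀,
    fun γ N ρ hN hρ1 hρ2 => ?_⟩
  obtain ⟨hcard, hlog, hN1⟩ := hN₀ N hN
  obtain ⟨hlow, hdvd⟩ := hcard γ ρ hρ1 hρ2
  have hN1' : (1 : ℝ) ≤ N := by exact_mod_cast hN1
  have hX1 : 1 ≤ (N : ℝ) ^ (2 * bohrEps α) := Real.one_le_rpow hN1' (by linarith)
  have hρ0 : 0 < ρ := lt_of_lt_of_le (by positivity) hρ1
  have hB : ∀ n ∈ bohrSetStar N γ α ρ, n ≠ 0 ∧ n ≤ N := by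
    intro n hn
    simp only [bohrSetStar, bohrSet, Finset.mem_filter, Finset.mem_Icc] at hn
    exact ⟨by omega, hn.1.1.2⟩
  constructor
  · have hsum := sum_sum_inv_primeFactors_le hB hlog hX1 (by positivity) hdvd
    have := card_mul_exp_le_sum_totient_div (K := 60) (fun n hn => (hB n hn).1) (by linarith)
    refine le_trans ?_ this
    calc Real.exp (-(2 * 60)) / 2 * (ρ * N) = Real.exp (-(2 * 60)) * (ρ * N / 2) := by ring
      _ ≤ _ := by gcongr
  · calc ∑ n ∈ bohrSetStar N γ α ρ, (Nat.totient n : ℝ) / n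
        ≤ ∑ n ∈ bohrSetStar N γ α ρ, (1 : ℝ) := by
          refine Finset.sum_le_sum fun n _ => div_le_one_of_le₀ ?_ (Nat.cast_nonneg _)
          exact_mod_cast Nat.totient_le n
      _ = ((bohrSetStar N γ α ρ).card : ℝ) := by simp
      _ ≤ 10 * (ρ * N) := by
          have := hdvd 1 le_rfl (by simpa using hX1)
          simp only [one_dvd, Finset.filter_true, Nat.cast_one, div_one] at this
          linarith
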